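/- Let $k \neq 0$ be a commutative unital ring and let $c \geq 1$ be an integer. Let $\mathbf{N}_c$ be the category of finitely generated free nilpotent groups of class at most $c$, that is (up to the choice of a skeleton), the category with objects $n \in \mathbb{N} = \{0,1,2,\dots\}$ and with morphisms $n \to m$ the group homomorphisms $F_n/\gamma_{c+1}(F_n) \to F_m/\gamma_{c+1}(F_m)$, where $F_n$ is the free group of rank $n$ and $\gamma_1 \supseteq \gamma_2 \supseteq \cdots$ is the lower central series. It is monoidal under the coproduct $\vee$, and its unit is a zero object $\ast$; its opposite $\mathbf{N}_c^{\mathrm{op}}$ carries the opposite monoidal structure. Let $\mathcal{C}$ be $\mathbf{N}_c$ or $\mathbf{N}_c^{\mathrm{op}}$, with monoidal product again written $\vee$. A $\mathcal{C}$-module is a functor $F$ from $\mathcal{C}$ to the category of $k$-modules. For $n \geq 0$, its $n$-th cross effect at objects $X_1,\dots,X_n$ is the kernel of the map $$F(X_1 \vee \cdots \vee X_n) \longrightarrow \bigoplus_{i=1}^{n} F(X_1 \vee \cdots \vee X_{i-1} \vee X_{i+1} \vee \cdots \vee X_n)$$ whose $i$-th component is induced by the unique morphism $X_i \to \ast$ and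 by the identities of the other $X_j$ (so the $0$-th cross effect is $F(\ast)$). For $d \in \mathbb{N}$, the module $F$ has degree at most $d$ if its $(d+1)$-th cross effect vanishes at all objects, and it has degree equal to $d$ if moreover its $d$-th cross effect does not vanish at all objects. Let $\mathrm{D}(\mathcal{C})$ be the set of all $d \in \mathbb{N}$ for which there is a $\mathcal{C}$-module of degree equal to $d$. Then $$\mathrm{D}(\mathcal{C}) = \mathbb{N}.$$ Furthermore, for every $d \in \mathbb{N}$ there is a $\mathcal{C}$-module $P$ of degree equal to $d$ that is a faithful, small projective object of the full subcategory of $\mathcal{C}$-modules of degree at most $d$; that is, in this subcategory $P$ is projective, and the functor $\mathrm{Hom}(P,-)$ to abelian groups is faithful ($P$ is a generator) and preserves all coproducts indexed by sets ($P$ is small). -/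

import Mathlib

open CategoryTheory CategoryTheory.Limits MonoidalCategory Opposite

universe u v w

/-! ### Polynomial functors on monoidal categories with zero unit -/

/-- A monoidal category with zero unit: the unit object is a zero object. -/
class ZeroUnit (C : Type w) [Category.{v} C] [MonoidalCategory C] : Prop where
  isZero_unit : IsZero (𝟙_ C)

instance ZeroUnit.opposite (C : Type w) [Category.{v} C] [MonoidalCategory C] [ZeroUnit C] :
    ZeroUnit Cᵒᵖ where
  isZero_unit := (ZeroUnit.isZero_unit (C := C)).op

section Polynomial

variable {C : Type w} [Category.{v} C] [MonoidalCategory C] [ZeroUnit C]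

/-- The unique morphism from `X` to the unit, which is a zero object. -/
noncomputable def counitMap (X : C) : X ⟶ 𝟙_ C :=
  (ZeroUnit.isZero_unit (C := C)).from_ X

/-- The monoidal product `X₁ ∨ (X₂ ∨ ⋯ (Xₙ ∨ 𝟙))` of a list of objects. -/
def tensorList : List C → C
  | [] => 𝟙_ C
  | X :: L => X ⊗ tensorList L

/-- The morphism `X₁ ∨ ⋯ ∨ Xₙ ⟶ X₁ ∨ ⋯ ∨ Xₖ₋₁ ∨ Xₖ₊₁ ∨ ⋯ ∨ Xₙ` induced by the unique morphism
from `Xₖ` to the unit and by identities elsewhere (positions are counted from `0`; a position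
outside the list gives the identity). -/
noncomputable def omitMap : (L : List C) → (i : ℕ) → (tensorList L ⟶ tensorList (L.eraseIdx i))
  | [], _ => 𝟙 (𝟙_ C)
  | X :: L, 0 => (counitMap X ▷ tensorList L) ≫ (λ_ (tensorList L)).hom
  | X :: L, i + 1 => X ◁ omitMap L i

variable {k : Type u} [CommRing k]

/-- The value at `(X₁, …, Xₙ)` of the `n`-th cross effect of `F`: the kernel of the canonical map
`F (X₁ ∨ ⋯ ∨ Xₙ) → ⨁ᵢ F (X₁ ∨ ⋯ ∨ Xᵢ₋₁ ∨ Xᵢ₊₁ ∨ ⋯ ∨ Xₙ)`, where `L = [X₁, …, Xₙ]`. -/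
noncomputable def crossEffect (F : C ⥤ ModuleCat.{u} k) (L : List C) :
    Submodule k (F.obj (tensorList L)) :=
  LinearMap.ker (LinearMap.pi fun i : Fin L.length => (F.map (omitMap L i)).hom)

/-- The `n`-th cross effect of `F` vanishes. -/
def CrossEffectVanishes (F : C ⥤ ModuleCat.{u} k) (n : ℕ) : Prop :=
  ∀ L : List C, L.length = n → crossEffect F L = ⊥

/-- `F` is polynomial of degree at most `d`: its `(d+1)`-th cross effect vanishes. -/
def DegreeLE (F : C ⥤ ModuleCat.{u} k) (d : ℕ) : Prop :=
  CrossEffectVanishes F (d + 1)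

/-- `F` is polynomial of degree equal to `d`: the degree is at most `d` but not at most `d - 1`,
that is, the `(d+1)`-th cross effect vanishes and the `d`-th one does not. The `0`-th cross effect
is the value of `F` at the unit, so that degree `0` means constant and nonzero. -/
def DegreeEq (F : C ⥤ ModuleCat.{u} k) (d : ℕ) : Prop :=
  DegreeLE F d ∧ ¬ CrossEffectVanishes F d

variable (k C) in
/-- The set of all `d` for which there is a `C`-module (over `k`) of degree equal to `d`. -/
def degreeSet : Set ℕ :=
  {d | ∃ F : C ⥤ ModuleCat.{u} k, DegreeEq F d}

variable (k C) in
/-- The category of `C`-modules (over `k`) of degree at most `d`, a full subcategory of the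
category of all functors from `C` to `k`-modules. -/
abbrev PolyModules (d : ℕ) :=
  ObjectProperty.FullSubcategory fun F : C ⥤ ModuleCat.{u} k => DegreeLE F d

end Polynomial

/-- `P` is a faithful, small projective object of a preadditive category `A`: the functor
`Hom(P, -)` to abelian groups is faithful (`P` is a generator), it preserves coproducts
(indexed by types of size `u`), and `P` is projective. -/
structure IsFaithfulSmallProjective {A : Type w} [Category.{v} A] [Preadditive A] (P : A) :
    Prop where
  faithful : (preadditiveCoyoneda.obj (op P)).Faithful
  small : ∀ J : Type u, PreservesColimitsOfShape (Discrete J) (preadditiveCoyoneda.obj (op P))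
  projective : Projective P

/-! ### The category of finitely generated free nilpotent groups of class at most `c` -/

/-- The free nilpotent group of class at most `c` and rank `n`: the quotient of the free group of
rank `n` by the subgroup `γ_{c+1}` of its lower central series `γ₁ ⊇ γ₂ ⊇ ⋯`
(Mathlib's numbering starts at `0`). -/
abbrev FreeNilGroup (c n : ℕ) : Type :=
  FreeGroup (Fin n) ⧸ (⊤ : Subgroup (FreeGroup (Fin n))).lowerCentralSeries c

/-- The category of finitely generated free nilpotent groups of class at most `c`, in the form of
its skeleton: the objects are the ranks `n`, and the morphisms are the group homomorphisms between
the corresponding groups `FreeNilGroup c n`. -/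
structure FreeNil (c : ℕ) where
  rank : ℕ

namespace FreeNil

variable {c : ℕ}

/-- The group that corresponds to an object. -/
abbrev Grp (X : FreeNil c) : Type := FreeNilGroup c X.rank

instance : Category.{0} (FreeNil c) where
  Hom X Y := X.Grp →* Y.Grp
  id X := MonoidHom.id X.Grp
  comp f g := MonoidHom.comp g f

theorem lowerCentralSeries_eq_bot (c n : ℕ) :
    (⊤ : Subgroup (FreeNilGroup c n)).lowerCentralSeries c = ⊥ := by
  have hs := QuotientGroup.mk'_surjective
    ((⊤ : Subgroup (FreeGroup (Fin n))).lowerCentralSeries c)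
  rw [← Subgroup.map_top_of_surjective _ hs, ← Subgroup.map_lowerCentralSeries,
    QuotientGroup.map_mk'_self]

/-- The homomorphism with prescribed values on the free generators. -/
def lift {X Y : FreeNil c} (f : Fin X.rank → Y.Grp) : X ⟶ Y :=
  QuotientGroup.lift _ (FreeGroup.lift f) (by
    intro x hx
    have h1 : FreeGroup.lift f x ∈
        ((⊤ : Subgroup (FreeGroup (Fin X.rank))).lowerCentralSeries c).map (FreeGroup.lift f) :=
      Subgroup.mem_map_of_mem _ hx
    rw [Subgroup.map_lowerCentralSeries] at h1
    have h2 : FreeGroup.lift f x ∈ (⊤ : Subgroup Y.Grp).lowerCentralSeries c :=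
      Subgroup.lowerCentralSeries_mono c
      (le_top : (⊤ : Subgroup (FreeGroup (Fin X.rank))).map (FreeGroup.lift f) ≤ ⊤) h1
    rwa [lowerCentralSeries_eq_bot, Subgroup.mem_bot] at h2)

/-- The free generators. -/
def gen (X : FreeNil c) (i : Fin X.rank) : X.Grp :=
  QuotientGroup.mk (FreeGroup.of i)

/-- A morphism as a group homomorphism. -/
abbrev toHom {X Y : FreeNil c} (f : X ⟶ Y) : X.Grp →* Y.Grp := f

theorem toHom_comp {X Y Z : FreeNil c} (f : X ⟶ Y) (g : Y ⟶ Z) (x : X.Grp) :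
    toHom (f ≫ g) x = toHom g (toHom f x) :=
  rfl

theorem lift_gen {X Y : FreeNil c} (f : Fin X.rank → Y.Grp) (i : Fin X.rank) :
    toHom (lift f) (X.gen i) = f i :=
  FreeGroup.lift_apply_of

theorem hom_ext {X Y : FreeNil c} {f g : X ⟶ Y}
    (h : ∀ i, toHom f (X.gen i) = toHom g (X.gen i)) : f = g := by
  apply QuotientGroup.monoidHom_ext
  apply FreeGroup.ext_hom
  exact h

/-- The object of rank `0` is a zero object. -/
theorem isZero_zero : IsZero (⟨0⟩ : FreeNil c) where
  unique_to Y := ⟨⟨⟨lift fun i => Fin.elim0 i⟩, fun _ => hom_ext fun i => Fin.elim0 i⟩⟩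
  unique_from X := ⟨⟨⟨lift fun _ => 1⟩, fun f => hom_ext fun i => by
    have : Subsingleton (Grp (⟨0⟩ : FreeNil c)) :=
      (QuotientGroup.mk_surjective (s := (⊤ : Subgroup (FreeGroup (Fin 0))).lowerCentralSeries c)
        ).subsingleton
    exact Subsingleton.elim _ _⟩⟩

/-- The object of rank `m + n`, where `m` and `n` are the ranks of `X` and `Y`. -/
abbrev add (X Y : FreeNil c) : FreeNil c := ⟨X.rank + Y.rank⟩

/-- The inclusion onto the first generators. -/
def inl (X Y : FreeNil c) : X ⟶ add X Y :=
  lift fun i => (add X Y).gen (Fin.castAdd Y.rank i)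

/-- The inclusion onto the last generators. -/
def inr (X Y : FreeNil c) : Y ⟶ add X Y :=
  lift fun j => (add X Y).gen (Fin.natAdd X.rank j)

/-- The morphism on `add X Y` with prescribed restrictions to `X` and `Y`. -/
def desc {X Y Z : FreeNil c} (f : X ⟶ Z) (g : Y ⟶ Z) : add X Y ⟶ Z :=
  lift (X := add X Y)
    (Fin.addCases (fun i => toHom f (X.gen i)) fun j => toHom g (Y.gen j))

theorem inl_desc {X Y Z : FreeNil c} (f : X ⟶ Z) (g : Y ⟶ Z) : inl X Y ≫ desc f g = f :=
  hom_ext fun i => by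
    rw [toHom_comp, inl, lift_gen, desc, lift_gen, Fin.addCases_left]

theorem inr_desc {X Y Z : FreeNil c} (f : X ⟶ Z) (g : Y ⟶ Z) : inr X Y ≫ desc f g = g :=
  hom_ext fun j => by
    rw [toHom_comp, inr, lift_gen, desc, lift_gen, Fin.addCases_right]

theorem add_hom_ext {X Y Z : FreeNil c} {f g : add X Y ⟶ Z} (h₁ : inl X Y ≫ f = inl X Y ≫ g)
    (h₂ : inr X Y ≫ f = inr X Y ≫ g) : f = g :=
  hom_ext fun i => by
    refine Fin.addCases (fun a => ?_) (fun b => ?_) i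
    · have h := DFunLike.congr_fun (congrArg toHom h₁) (X.gen a)
      rwa [toHom_comp, toHom_comp, inl, lift_gen] at h
    · have h := DFunLike.congr_fun (congrArg toHom h₂) (Y.gen b)
      rwa [toHom_comp, toHom_comp, inr, lift_gen] at h

/-- The object `add X Y` is the coproduct of `X` and `Y`. -/
def isColimitAdd (X Y : FreeNil c) : IsColimit (BinaryCofan.mk (inl X Y) (inr X Y)) :=
  BinaryCofan.isColimitMk (fun s => desc s.inl s.inr) (fun _ => inl_desc _ _)
    (fun _ => inr_desc _ _) fun _ _ h₁ h₂ =>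
      add_hom_ext (h₁.trans (inl_desc _ _).symm) (h₂.trans (inr_desc _ _).symm)

instance : HasInitial (FreeNil c) :=
  isZero_zero.isInitial.hasInitial

instance : HasBinaryCoproducts (FreeNil c) :=
  have : ∀ X Y : FreeNil c, HasColimit (pair X Y) := fun X Y =>
    ⟨⟨⟨_, isColimitAdd X Y⟩⟩⟩
  hasBinaryCoproducts_of_hasColimit_pair _

/-- The monoidal structure given by the coproducts (free products of groups, made nilpotent of class
at most `c`). The opposite category carries the opposite structure, given by the products there. -/
noncomputable instance : MonoidalCategory (FreeNil c) :=
  monoidalOfHasFiniteCoproducts (FreeNil c)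

instance : ZeroUnit (FreeNil c) where
  isZero_unit := isZero_zero.of_iso (initialIsInitial.uniqueUpToIso isZero_zero.isInitial)

end FreeNil

/-! On `F (X₁ ∨ ⋯ ∨ Xₙ)` the endomorphisms `eᵢ` that kill one factor are commuting idempotents. The
cross effect is their joint kernel, hence the image of the projector `∏ (1 - eᵢ)`, which is natural
in `F` (`map_crossProj`). So modules of degree at most `d` are closed under colimits, and `k[Hom(Z,
-)]` has a universal quotient of degree at most `d`. By Yoneda this quotient `P` corepresents
evaluation at `Z`. Evaluation preserves colimits, so `P` is small and projective.

Let `Z` be the product of `d` copies of the rank one object. A natural transformation into a module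
of degree at most `d` is determined by its component at `Z` (`app_eq_of_app_eq`), so `P` is a
generator. If some `F` of degree at most `d` has a nonzero cross effect at these `d` copies, then so
has `P`, because any element of `F Z` is the image of the universal one
(`exists_faithfulSmallProjective`).

Only the choice of `F` involves groups. In the contravariant case `F` consists of the `k`-valued
functions of `d` variables that are additive in each variable; in the covariant case it is the
linear dual of this. Such a function on a sum of `d + 1` groups is determined by tuples of elements
of single summands, and `d` entries always miss one summand (`multiAdd_eq_zero_of_pullback`). On `d`
copies of rank one, the product of the coordinate characters and the evaluation at the tuple of
generators give nonzero elements of the two cross effects. -/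

/-! ### Complements of commuting idempotents -/

section Complement

variable {R : Type*} [Ring R]

/-- The product of the complements `1 - e i`, where `i` runs through the list `l`. -/
def complProd {ι : Type*} (e : ι → R) (l : List ι) : R :=
  (l.map fun i => 1 - e i).prod

/-- By commutativity `e i` can be moved next to its own complement, and `e i * (1 - e i) = 0`. -/
theorem mul_complProd_eq_zero {ι : Type*} (e : ι → R) (hc : ∀ i j, e i * e j = e j * e i)
    (he : ∀ i, e i * e i = e i) (l : List ι) {i : ι} (hi : i ∈ l) : e i * complProd e l = 0 := by
  induction l with
  | nil => simp at hi
  | cons j l ih =>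
    have h : complProd e (j :: l) = (1 - e j) * complProd e l := by simp [complProd]
    rw [h]
    by_cases hij : i = j
    · subst hij
      rw [← mul_assoc, mul_sub, he, mul_one, sub_self, zero_mul]
    · have hi' : i ∈ l := by simpa [hij] using hi
      have h1 : e i * (1 - e j) = (1 - e j) * e i := by
        rw [mul_sub, sub_mul, hc, mul_one, one_mul]
      rw [← mul_assoc, h1, mul_assoc, ih hi', mul_zero]

variable {k : Type*} [CommRing k] {M N : Type*} [AddCommGroup M] [Module k M]
  [AddCommGroup N] [Module k N]

theorem complProd_cons_apply {ι : Type*} (e : ι → Module.End k M) (i : ι) (l : List ι) (x : M) :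
    complProd e (i :: l) x = complProd e l x - e i (complProd e l x) := by
  simp [complProd]

theorem complProd_nil_apply {ι : Type*} (e : ι → Module.End k M) (x : M) :
    complProd e [] x = x := by
  simp [complProd]

theorem complProd_apply_of_eq_zero {ι : Type*} (e : ι → Module.End k M) (l : List ι) (x : M)
    (hx : ∀ i ∈ l, e i x = 0) : complProd e l x = x := by
  induction l with
  | nil => exact complProd_nil_apply e x
  | cons i l ih =>
    rw [complProd_cons_apply, ih fun j hj => hx j (List.mem_cons_of_mem _ hj),
      hx i List.mem_cons_self, sub_zero]

theorem map_complProd_apply {ι : Type*} (e : ι → Module.End k M) (e' : ι → Module.End k N)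
    (φ : M →ₗ[k] N) (h : ∀ i x, φ (e i x) = e' i (φ x)) (l : List ι) (x : M) :
    φ (complProd e l x) = complProd e' l (φ x) := by
  induction l with
  | nil => simp [complProd]
  | cons i l ih => rw [complProd_cons_apply, complProd_cons_apply, map_sub, h, ih]

/-- Expanding the product, every term other than `1` begins with some `e i`, which `φ` kills. This
serves for the dual functor, where idempotents act by precomposition. -/
theorem map_complProd_apply_of_eq_zero {ι : Type*} (e : ι → Module.End k M)
    (φ : M →ₗ[k] N) (l : List ι) (h : ∀ i ∈ l, ∀ x, φ (e i x) = 0) (x : M) :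
    φ (complProd e l x) = φ x := by
  induction l with
  | nil => simp [complProd]
  | cons i l ih =>
    rw [complProd_cons_apply, map_sub, h i List.mem_cons_self,
      ih fun j hj => h j (List.mem_cons_of_mem _ hj), sub_zero]

end Complement

/-! ### The idempotents that define cross effects -/

section Idempotents

variable {C : Type w} [Category.{v} C] [MonoidalCategory C] [ZeroUnit C]

/-- The unique morphism from the unit, which is a zero object, to `X`. -/
noncomputable def unitMap (X : C) : 𝟙_ C ⟶ X :=
  (ZeroUnit.isZero_unit (C := C)).to_ X

theorem to_unit_ext {X : C} (f g : X ⟶ 𝟙_ C) : f = g :=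
  (ZeroUnit.isZero_unit (C := C)).eq_of_tgt f g

theorem from_unit_ext {X : C} (f g : 𝟙_ C ⟶ X) : f = g :=
  (ZeroUnit.isZero_unit (C := C)).eq_of_src f g

/-- The endomorphism of `X` that factors through the zero object. -/
noncomputable def zeroEnd (X : C) : X ⟶ X :=
  counitMap X ≫ unitMap X

/-- The endomorphism of `X₁ ∨ ⋯ ∨ Xₙ` that is trivial on one factor and the identity on the
other factors. -/
noncomputable def omitEnd : (L : List C) → (i : ℕ) → (tensorList L ⟶ tensorList L)
  | [], _ => 𝟙 (𝟙_ C)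
  | X :: L, 0 => zeroEnd X ▷ tensorList L
  | X :: L, i + 1 => X ◁ omitEnd L i

/-- The section of `omitMap L i`. -/
noncomputable def insertMap : (L : List C) → (i : ℕ) →
    (tensorList (L.eraseIdx i) ⟶ tensorList L)
  | [], _ => 𝟙 (𝟙_ C)
  | X :: L, 0 => (λ_ (tensorList L)).inv ≫ (unitMap X ▷ tensorList L)
  | X :: L, i + 1 => X ◁ insertMap L i

theorem omitMap_insertMap (L : List C) (i : ℕ) : omitMap L i ≫ insertMap L i = omitEnd L i := by
  induction L generalizing i with
  | nil => exact Category.id_comp _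
  | cons X L ih =>
    cases i with
    | zero =>
      change ((counitMap X ▷ tensorList L) ≫ (λ_ (tensorList L)).hom) ≫
        (λ_ (tensorList L)).inv ≫ (unitMap X ▷ tensorList L) = zeroEnd X ▷ tensorList L
      simp [zeroEnd]
    | succ i =>
      change X ◁ omitMap L i ≫ X ◁ insertMap L i = X ◁ omitEnd L i
      rw [← whiskerLeft_comp, ih]

theorem insertMap_omitMap (L : List C) (i : ℕ) : insertMap L i ≫ omitMap L i = 𝟙 _ := by
  induction L generalizing i with
  | nil => exact Category.id_comp _
  | cons X L ih =>
    cases i with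
    | zero =>
      change ((λ_ (tensorList L)).inv ≫ (unitMap X ▷ tensorList L)) ≫
        (counitMap X ▷ tensorList L) ≫ (λ_ (tensorList L)).hom = 𝟙 (tensorList L)
      have h : unitMap X ≫ counitMap X = 𝟙 (𝟙_ C) := to_unit_ext _ _
      rw [Category.assoc, ← comp_whiskerRight_assoc, h]
      simp
    | succ i =>
      change X ◁ insertMap L i ≫ X ◁ omitMap L i = 𝟙 (X ⊗ tensorList (L.eraseIdx i))
      rw [← whiskerLeft_comp, ih, whiskerLeft_id]

theorem omitEnd_idem (L : List C) (i : ℕ) : omitEnd L i ≫ omitEnd L i = omitEnd L i := by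
  rw [← omitMap_insertMap, Category.assoc, ← Category.assoc (insertMap L i), insertMap_omitMap,
    Category.id_comp]

theorem omitEnd_comm (L : List C) (i j : ℕ) :
    omitEnd L i ≫ omitEnd L j = omitEnd L j ≫ omitEnd L i := by
  induction L generalizing i j with
  | nil => rfl
  | cons X L ih =>
    rcases i with _ | i <;> rcases j with _ | j
    · rfl
    · exact (whisker_exchange _ _).symm
    · exact whisker_exchange _ _
    · change X ◁ omitEnd L i ≫ X ◁ omitEnd L j = X ◁ omitEnd L j ≫ X ◁ omitEnd L i
      rw [← whiskerLeft_comp, ih, whiskerLeft_comp]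

end Idempotents

/-! ### Cross effects as images of idempotents -/

section CrossEffect

variable {C : Type w} [Category.{v} C] [MonoidalCategory C] [ZeroUnit C]
  {k : Type u} [CommRing k]

theorem ModuleCat.map_comp_hom_apply {D : Type*} [Category D] (F : D ⥤ ModuleCat.{u} k)
    {X Y Z : D} (f : X ⟶ Y) (g : Y ⟶ Z) (x : F.obj X) :
    (F.map (f ≫ g)).hom x = (F.map g).hom ((F.map f).hom x) := by
  rw [F.map_comp]
  rfl

theorem ModuleCat.naturality_hom_apply {D : Type*} [Category D] {F G : D ⥤ ModuleCat.{u} k}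
    (φ : F ⟶ G) {X Y : D} (f : X ⟶ Y) (x : F.obj X) :
    (φ.app Y).hom ((F.map f).hom x) = (G.map f).hom ((φ.app X).hom x) := by
  have h := φ.naturality f
  exact DFunLike.congr_fun (congrArg ModuleCat.Hom.hom h) x

/-- The idempotent on `F (X₁ ∨ ⋯ ∨ Xₙ)` whose image is the cross effect. -/
noncomputable def crossProj (F : C ⥤ ModuleCat.{u} k) (L : List C) :
    Module.End k (F.obj (tensorList L)) :=
  complProd (fun i => (F.map (omitEnd L i)).hom) (List.range L.length)

variable (F : C ⥤ ModuleCat.{u} k) (L : List C)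

/-- Since `omitMap` is split by `insertMap`, it induces a map with the same kernel as the idempotent
`omitEnd`. -/
theorem mem_crossEffect_iff (x : F.obj (tensorList L)) :
    x ∈ crossEffect F L ↔ ∀ i < L.length, (F.map (omitEnd L i)).hom x = 0 := by
  have h : x ∈ crossEffect F L ↔ ∀ i : Fin L.length, (F.map (omitMap L i)).hom x = 0 := by
    rw [crossEffect, LinearMap.mem_ker, funext_iff]
    rfl
  rw [h, Fin.forall_iff]
  refine forall₂_congr fun i hi => ⟨fun h => ?_, fun h => ?_⟩
  · change (F.map (omitMap L i)).hom x = 0 at h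
    rw [← omitMap_insertMap, ModuleCat.map_comp_hom_apply, h, map_zero]
  · change (F.map (omitMap L i)).hom x = 0
    have h1 : omitMap L i = omitEnd L i ≫ omitMap L i := by
      rw [← omitMap_insertMap, Category.assoc, insertMap_omitMap, Category.comp_id]
    rw [h1, ModuleCat.map_comp_hom_apply, h, map_zero]

theorem crossProj_mem (x : F.obj (tensorList L)) : crossProj F L x ∈ crossEffect F L := by
  rw [mem_crossEffect_iff]
  intro i hi
  have h := mul_complProd_eq_zero (fun i => ((F.map (omitEnd L i)).hom : Module.End k _))
    (fun i j => LinearMap.ext fun x => by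
      change (F.map (omitEnd L i)).hom ((F.map (omitEnd L j)).hom x) =
        (F.map (omitEnd L j)).hom ((F.map (omitEnd L i)).hom x)
      rw [← ModuleCat.map_comp_hom_apply, ← ModuleCat.map_comp_hom_apply, omitEnd_comm])
    (fun i => LinearMap.ext fun x => by
      change (F.map (omitEnd L i)).hom ((F.map (omitEnd L i)).hom x) =
        (F.map (omitEnd L i)).hom x
      rw [← ModuleCat.map_comp_hom_apply, omitEnd_idem])
    (List.range L.length) (List.mem_range.2 hi)
  exact DFunLike.congr_fun h x

theorem crossProj_of_mem {x : F.obj (tensorList L)} (hx : x ∈ crossEffect F L) :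
    crossProj F L x = x :=
  complProd_apply_of_eq_zero _ _ _ fun i hi =>
    (mem_crossEffect_iff F L x).1 hx i (List.mem_range.1 hi)

variable {F} in
-- The projector is a polynomial in maps induced by morphisms of `C`, so natural transformations
-- commute with it.
theorem map_crossProj {G : C ⥤ ModuleCat.{u} k} (φ : F ⟶ G) (x : F.obj (tensorList L)) :
    (φ.app _).hom (crossProj F L x) = crossProj G L ((φ.app _).hom x) :=
  map_complProd_apply _ _ _ (fun _ _ => ModuleCat.naturality_hom_apply φ _ _) _ _

variable {F} in
theorem map_mem_crossEffect {G : C ⥤ ModuleCat.{u} k} (φ : F ⟶ G) {x : F.obj (tensorList L)}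
    (hx : x ∈ crossEffect F L) : (φ.app _).hom x ∈ crossEffect G L := by
  rw [← crossProj_of_mem F L hx, map_crossProj]
  exact crossProj_mem _ _ _

theorem crossEffect_eq_bot_iff : crossEffect F L = ⊥ ↔ crossProj F L = 0 := by
  rw [Submodule.eq_bot_iff]
  refine ⟨fun h => LinearMap.ext fun x => h _ (crossProj_mem F L x), fun h x hx => ?_⟩
  rw [← crossProj_of_mem F L hx, h, LinearMap.zero_apply]

end CrossEffect

/-! ### Polynomial functors are closed under colimits -/

section Closure

variable {C : Type w} [Category.{v} C] [MonoidalCategory C] [ZeroUnit C]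
  {k : Type u} [CommRing k]

variable (C k) in
/-- The class of polynomial functors of degree at most `d`. -/
abbrev polyProperty (d : ℕ) : ObjectProperty (C ⥤ ModuleCat.{u} k) :=
  fun F => DegreeLE F d

theorem degreeLE_iff (F : C ⥤ ModuleCat.{u} k) (d : ℕ) :
    DegreeLE F d ↔ ∀ L : List C, L.length = d + 1 → crossProj F L = 0 :=
  forall₂_congr fun L _ => crossEffect_eq_bot_iff F L

/-- Vanishing of the natural projector can be tested on the jointly epimorphic legs of a pointwise
colimit. Consequently colimits in `PolyModules` are computed pointwise. -/
instance polyProperty_closedUnderColimits (d : ℕ) (J : Type*) [Category J]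
    [HasColimitsOfShape J (ModuleCat.{u} k)] :
    (polyProperty C k d).IsClosedUnderColimitsOfShape J where
  colimitsOfShape_le := by
    rintro F ⟨p⟩
    refine (degreeLE_iff F d).2 fun L hL => ?_
    have hc := isColimitOfPreserves ((evaluation C (ModuleCat.{u} k)).obj (tensorList L))
      p.isColimit
    have h : ModuleCat.ofHom (crossProj F L) = 0 := by
      refine hc.hom_ext fun j => ?_
      ext x
      change crossProj F L (((p.ι.app j).app (tensorList L)).hom x) = 0
      rw [← map_crossProj, (degreeLE_iff _ d).1 (p.prop_diag_obj j) L hL, LinearMap.zero_apply,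
        map_zero]
    exact congrArg ModuleCat.Hom.hom h

end Closure

/-! ### The universal polynomial quotient of a representable functor -/

section Universal

variable {C : Type} [Category.{0} C]

variable (k : Type u) [CommRing k]

/-- The linearization `k[Hom(Z, -)]` of a representable functor. -/
noncomputable def linRep (Z : C) : C ⥤ ModuleCat.{u} k where
  obj Y := ModuleCat.of k ((Z ⟶ Y) →₀ k)
  map f := ModuleCat.ofHom (Finsupp.lmapDomain k k fun g => g ≫ f)
  map_id Y := by
    refine ModuleCat.hom_ext (Finsupp.lhom_ext fun g a => ?_)
    exact Finsupp.mapDomain_single.trans (by rw [Category.comp_id]; rfl)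
  map_comp f f' := by
    refine ModuleCat.hom_ext (Finsupp.lhom_ext fun g a => ?_)
    refine Finsupp.mapDomain_single.trans ?_
    rw [← Category.assoc]
    change _ = Finsupp.mapDomain _ (Finsupp.mapDomain _ (Finsupp.single g a))
    rw [Finsupp.mapDomain_single, Finsupp.mapDomain_single]

theorem linRep_map_single {Z Y Y' : C} (f : Y ⟶ Y') (g : Z ⟶ Y) (a : k) :
    ((linRep k Z).map f).hom (Finsupp.single g a) = Finsupp.single (g ≫ f) a :=
  Finsupp.mapDomain_single

variable [MonoidalCategory C] [ZeroUnit C]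

variable {k} in
/-- The submodule generated by the images of the cross effects of order `d + 1`. -/
def crossSpan (F : C ⥤ ModuleCat.{u} k) (d : ℕ) (Y : C) : Submodule k (F.obj Y) :=
  Submodule.span k {y | ∃ (L : List C) (_ : L.length = d + 1) (f : tensorList L ⟶ Y),
    ∃ x ∈ crossEffect F L, (F.map f).hom x = y}

variable {k} in
theorem crossSpan_le_comap (F : C ⥤ ModuleCat.{u} k) (d : ℕ) {Y Y' : C} (g : Y ⟶ Y') :
    crossSpan F d Y ≤ (crossSpan F d Y').comap (F.map g).hom := by
  refine Submodule.span_le.2 ?_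
  rintro _ ⟨L, hL, f, x, hx, rfl⟩
  refine Submodule.subset_span ⟨L, hL, f ≫ g, x, hx, ?_⟩
  rw [ModuleCat.map_comp_hom_apply]

variable {k} in
/-- The universal quotient of degree at most `d` of a functor. -/
noncomputable def polyQuotient (F : C ⥤ ModuleCat.{u} k) (d : ℕ) : C ⥤ ModuleCat.{u} k where
  obj Y := ModuleCat.of k (F.obj Y ⧸ crossSpan F d Y)
  map g := ModuleCat.ofHom (Submodule.mapQ _ _ (F.map g).hom (crossSpan_le_comap F d g))
  map_id Y := by
    refine ModuleCat.hom_ext (Submodule.linearMap_qext _ (LinearMap.ext fun x => ?_))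
    change (crossSpan F d Y).mkQ ((F.map (𝟙 Y)).hom x) = (crossSpan F d Y).mkQ x
    rw [F.map_id]
    rfl
  map_comp f g := by
    refine ModuleCat.hom_ext (Submodule.linearMap_qext _ (LinearMap.ext fun x => ?_))
    change (crossSpan F d _).mkQ ((F.map (f ≫ g)).hom x) =
      (crossSpan F d _).mkQ ((F.map g).hom ((F.map f).hom x))
    rw [ModuleCat.map_comp_hom_apply]

variable {k} in
/-- The projection onto the universal quotient of degree at most `d`. -/
noncomputable def toPolyQuotient (F : C ⥤ ModuleCat.{u} k) (d : ℕ) : F ⟶ polyQuotient F d where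
  app Y := ModuleCat.ofHom (crossSpan F d Y).mkQ
  naturality _ _ _ := rfl

variable {k} in
theorem toPolyQuotient_surjective (F : C ⥤ ModuleCat.{u} k) (d : ℕ) (Y : C) :
    Function.Surjective ((toPolyQuotient F d).app Y).hom :=
  Submodule.Quotient.mk_surjective _

variable {k} in
theorem degreeLE_polyQuotient (F : C ⥤ ModuleCat.{u} k) (d : ℕ) :
    DegreeLE (polyQuotient F d) d := by
  refine (degreeLE_iff _ d).2 fun L hL => LinearMap.ext fun y => ?_
  obtain ⟨x, rfl⟩ := toPolyQuotient_surjective F d _ y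
  rw [← map_crossProj]
  refine (Submodule.Quotient.mk_eq_zero _).2 (Submodule.subset_span
    ⟨L, hL, 𝟙 _, _, crossProj_mem F L x, ?_⟩)
  rw [F.map_id]
  rfl

variable {k} in
theorem crossSpan_le_ker {F G : C ⥤ ModuleCat.{u} k} {d : ℕ} (hG : DegreeLE G d) (φ : F ⟶ G)
    (Y : C) : crossSpan F d Y ≤ LinearMap.ker (φ.app Y).hom := by
  refine Submodule.span_le.2 ?_
  rintro _ ⟨L, hL, f, x, hx, rfl⟩
  have h := map_mem_crossEffect L φ hx
  rw [hG L hL, Submodule.mem_bot] at h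
  change (φ.app Y).hom _ = 0
  rw [ModuleCat.naturality_hom_apply, h, map_zero]

variable {k} in
/-- The extension to the universal quotient of a morphism to a functor of degree at most `d`. -/
noncomputable def polyQuotientDesc {F G : C ⥤ ModuleCat.{u} k} {d : ℕ} (hG : DegreeLE G d)
    (φ : F ⟶ G) : polyQuotient F d ⟶ G where
  app Y := ModuleCat.ofHom ((crossSpan F d Y).liftQ (φ.app Y).hom (crossSpan_le_ker hG φ Y))
  naturality Y Y' f := by
    refine ModuleCat.hom_ext (Submodule.linearMap_qext _ (LinearMap.ext fun x => ?_))
    exact ModuleCat.naturality_hom_apply φ f x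

variable {k} in
/-- The morphism from `k[Hom(Z, -)]` that corresponds to an element of `G Z`. -/
noncomputable def linRepDesc {Z : C} {G : C ⥤ ModuleCat.{u} k} (x : G.obj Z) :
    linRep k Z ⟶ G where
  app Y := ModuleCat.ofHom (Finsupp.linearCombination k fun g : Z ⟶ Y => (G.map g).hom x)
  naturality Y Y' f := by
    refine ModuleCat.hom_ext (Finsupp.lhom_ext' fun g => LinearMap.ext_ring ?_)
    change Finsupp.linearCombination k _ (Finsupp.mapDomain _ (Finsupp.single g (1 : k))) =
      (G.map f).hom (Finsupp.linearCombination k _ (Finsupp.single g (1 : k)))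
    rw [Finsupp.mapDomain_single, Finsupp.linearCombination_single,
      Finsupp.linearCombination_single, one_smul, one_smul, ModuleCat.map_comp_hom_apply]

/-- The functor that corepresents the evaluation at `Z` on functors of degree at most `d`. -/
noncomputable def polyRep (d : ℕ) (Z : C) : PolyModules C k d :=
  ⟨polyQuotient (linRep k Z) d, degreeLE_polyQuotient _ d⟩

/-- The universal element of `polyRep k d Z` at `Z`. -/
noncomputable def polyRepElem (d : ℕ) (Z : C) : (polyRep k d Z).obj.obj Z :=
  ((toPolyQuotient (linRep k Z) d).app Z).hom (Finsupp.single (𝟙 Z) 1)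

variable {k}

/-- The morphism from `polyRep k d Z` that corresponds to an element at `Z`. -/
noncomputable def polyRepDesc {d : ℕ} {Z : C} {G : C ⥤ ModuleCat.{u} k} (hG : DegreeLE G d)
    (x : G.obj Z) : (polyRep k d Z).obj ⟶ G :=
  polyQuotientDesc hG (linRepDesc x)

theorem polyRepDesc_elem {d : ℕ} {Z : C} {G : C ⥤ ModuleCat.{u} k} (hG : DegreeLE G d)
    (x : G.obj Z) : ((polyRepDesc hG x).app Z).hom (polyRepElem k d Z) = x := by
  change Finsupp.linearCombination k (fun g : Z ⟶ Z => (G.map g).hom x)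
    (Finsupp.single (𝟙 Z) (1 : k)) = x
  rw [Finsupp.linearCombination_single, one_smul, G.map_id]
  rfl

/-- Yoneda: the class of a basis element `g` is the image of the universal element under `g`, and
such classes span the quotient. -/
theorem polyRep_hom_ext {d : ℕ} {Z : C} {G : C ⥤ ModuleCat.{u} k}
    {φ ψ : (polyRep k d Z).obj ⟶ G}
    (h : (φ.app Z).hom (polyRepElem k d Z) = (ψ.app Z).hom (polyRepElem k d Z)) : φ = ψ := by
  have key : toPolyQuotient (linRep k Z) d ≫ φ = toPolyQuotient (linRep k Z) d ≫ ψ := by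
    ext Y : 2
    refine ModuleCat.hom_ext (Finsupp.lhom_ext' fun g => LinearMap.ext_ring ?_)
    have h1 : ((toPolyQuotient (linRep k Z) d).app Y).hom (Finsupp.single g 1) =
        ((polyRep k d Z).obj.map g).hom (polyRepElem k d Z) := by
      refine Eq.trans ?_ (ModuleCat.naturality_hom_apply (toPolyQuotient (linRep k Z) d) g _)
      rw [linRep_map_single, Category.id_comp]
    change (φ.app Y).hom (((toPolyQuotient (linRep k Z) d).app Y).hom (Finsupp.single g 1)) =
      (ψ.app Y).hom (((toPolyQuotient (linRep k Z) d).app Y).hom (Finsupp.single g 1))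
    rw [h1, ModuleCat.naturality_hom_apply, ModuleCat.naturality_hom_apply, h]
  ext Y : 2
  refine ModuleCat.hom_ext (LinearMap.ext fun y => ?_)
  obtain ⟨x, rfl⟩ := toPolyQuotient_surjective (linRep k Z) d Y y
  exact DFunLike.congr_fun (congrArg ModuleCat.Hom.hom (NatTrans.congr_app key Y)) x

/-- Morphisms from `polyRep k d Z` are elements at `Z`. -/
noncomputable def polyRepHomEquiv (d : ℕ) (Z : C) (G : PolyModules C k d) :
    (polyRep k d Z ⟶ G) ≃+ G.obj.obj Z where
  toFun φ := (φ.hom.app Z).hom (polyRepElem k d Z)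
  invFun x := ObjectProperty.homMk (polyRepDesc G.property x)
  left_inv _ := ObjectProperty.hom_ext _ (polyRep_hom_ext (polyRepDesc_elem G.property _))
  right_inv x := polyRepDesc_elem G.property x
  map_add' _ _ := rfl

variable (k) in
/-- `polyRep k d Z` corepresents the evaluation at `Z`. -/
noncomputable def polyRepIso (d : ℕ) (Z : C) :
    preadditiveCoyoneda.obj (op (polyRep k d Z)) ≅
      (polyProperty C k d).ι ⋙ (evaluation C (ModuleCat.{u} k)).obj Z ⋙
        forget₂ (ModuleCat.{u} k) AddCommGrpCat.{u} :=
  NatIso.ofComponents (fun G => (polyRepHomEquiv d Z G).toAddCommGrpIso) fun _ => rfl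

theorem polyRep_preservesColimits (d : ℕ) (Z : C) (J : Type*) [Category J]
    [HasColimitsOfShape J (ModuleCat.{u} k)]
    [PreservesColimitsOfShape J (forget₂ (ModuleCat.{u} k) AddCommGrpCat.{u})] :
    PreservesColimitsOfShape J (preadditiveCoyoneda.obj (op (polyRep k d Z))) :=
  preservesColimitsOfShape_of_natIso (polyRepIso k d Z).symm

theorem polyRep_projective (d : ℕ) (Z : C) : Projective (polyRep k d Z) := by
  rw [Projective.projective_iff_preservesEpimorphisms_preadditiveCoyoneda_obj]
  -- Epimorphisms are characterized by a pushout square, so preserving pushouts suffices.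
  have := polyRep_preservesColimits (k := k) d Z WalkingSpan
  exact preservesEpimorphisms_of_preservesColimitsOfShape _

end Universal

/-! ### Polynomial functors are determined by their value on a sum of `d` generators -/

section Detection

variable {C : Type w} [Category.{v} C] {k : Type u} [CommRing k] {F G : C ⥤ ModuleCat.{u} k}

theorem app_eq_of_retract {a b : F ⟶ G} {W Z : C} (s : W ⟶ Z) (r : Z ⟶ W) (h : s ≫ r = 𝟙 W)
    (hZ : a.app Z = b.app Z) : a.app W = b.app W := by
  have ha : a.app W = F.map s ≫ a.app Z ≫ G.map r := by
    rw [← a.naturality, ← Category.assoc, ← F.map_comp, h, F.map_id, Category.id_comp]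
  have hb : b.app W = F.map s ≫ b.app Z ≫ G.map r := by
    rw [← b.naturality, ← Category.assoc, ← F.map_comp, h, F.map_id, Category.id_comp]
  rw [ha, hb, hZ]

theorem app_eq_of_iso {a b : F ⟶ G} {W Z : C} (e : W ≅ Z) (hZ : a.app Z = b.app Z) :
    a.app W = b.app W :=
  app_eq_of_retract e.hom e.inv e.hom_inv_id hZ

variable [MonoidalCategory C]

theorem tensorList_iso_sum (N : ℕ → C) (h0 : Nonempty (𝟙_ C ≅ N 0))
    (hadd : ∀ m n, Nonempty (N m ⊗ N n ≅ N (m + n))) (L : List ℕ) :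
    Nonempty (tensorList (L.map N) ≅ N L.sum) := by
  induction L with
  | nil => exact h0
  | cons m L ih =>
    obtain ⟨e⟩ := ih
    obtain ⟨e'⟩ := hadd m L.sum
    exact ⟨whiskerLeftIso (N m) e ≪≫ e'⟩

theorem tensorList_replicate_iso (N : ℕ → C) (h0 : Nonempty (𝟙_ C ≅ N 0))
    (hadd : ∀ m n, Nonempty (N m ⊗ N n ≅ N (m + n))) (d : ℕ) :
    Nonempty (tensorList (List.replicate d (N 1)) ≅ N d) := by
  simpa using tensorList_iso_sum N h0 hadd (List.replicate d 1)

variable [ZeroUnit C]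

/-- The values of `a - b` die under every map omitting a factor, so they lie in a cross effect of
`G` of order `d + 1`, which is zero. -/
theorem app_tensorList_eq {d : ℕ} (hG : DegreeLE G d) (L : List C) (hL : L.length = d + 1)
    {a b : F ⟶ G} (h : ∀ i < L.length,
      a.app (tensorList (L.eraseIdx i)) = b.app (tensorList (L.eraseIdx i))) :
    a.app (tensorList L) = b.app (tensorList L) := by
  refine ModuleCat.hom_ext (LinearMap.ext fun x => sub_eq_zero.1 ?_)
  rw [← Submodule.mem_bot k, ← hG L hL, mem_crossEffect_iff]
  intro i hi
  rw [← omitMap_insertMap, ModuleCat.map_comp_hom_apply, map_sub,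
    ← ModuleCat.naturality_hom_apply, ← ModuleCat.naturality_hom_apply, h i hi, sub_self, map_zero]

theorem List.sum_eraseIdx_lt (L : List ℕ) (hL : ∀ m ∈ L, 1 ≤ m) {i : ℕ} (hi : i < L.length) :
    (L.eraseIdx i).sum < L.sum := by
  induction L generalizing i with
  | nil => simp at hi
  | cons m L ih =>
    have hm := hL m List.mem_cons_self
    cases i with
    | zero =>
      simp only [List.eraseIdx_cons_zero, List.sum_cons]
      omega
    | succ i =>
      have := ih (fun m hm => hL m (List.mem_cons_of_mem _ hm)) (i := i) (by simpa using hi)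
      simp only [List.eraseIdx_cons_succ, List.sum_cons]
      omega

theorem app_eq_of_app_eq (N : ℕ → C) (h0 : Nonempty (𝟙_ C ≅ N 0))
    (hadd : ∀ m n, Nonempty (N m ⊗ N n ≅ N (m + n))) {d : ℕ} (hG : DegreeLE G d) {a b : F ⟶ G}
    (h : a.app (N d) = b.app (N d)) (n : ℕ) : a.app (N n) = b.app (N n) := by
  induction n using Nat.strong_induction_on with
  | _ n ih =>
    rcases le_or_gt n d with hn | hn
    -- In small rank, `N n` is a retract of `N d`.
    · obtain ⟨m, rfl⟩ := Nat.exists_eq_add_of_le hn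
      obtain ⟨e⟩ := hadd n m
      have hr : ((ρ_ (N n)).inv ≫ N n ◁ unitMap (N m)) ≫ N n ◁ counitMap (N m) ≫
          (ρ_ (N n)).hom = 𝟙 (N n) := by
        have h1 : unitMap (N m) ≫ counitMap (N m) = 𝟙 (𝟙_ C) := to_unit_ext _ _
        rw [Category.assoc, ← whiskerLeft_comp_assoc, h1]
        simp
      exact app_eq_of_retract _ _ hr (app_eq_of_iso e h)
    · obtain ⟨m, rfl⟩ := Nat.exists_eq_add_of_lt hn
      -- The rank is split into exactly `d + 1` positive parts, so omitting any one of them gives a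
      -- smaller rank, where the induction hypothesis applies.
      let L : List ℕ := (m + 1) :: List.replicate d 1
      have hs : L.sum = d + m + 1 := by
        simp only [L, List.sum_cons, List.sum_replicate, smul_eq_mul]
        omega
      have hL : ∀ m ∈ L, 1 ≤ m := by
        intro m hm
        rcases List.mem_cons.1 hm with rfl | hm
        · omega
        · exact (List.eq_of_mem_replicate hm).ge
      obtain ⟨e⟩ := tensorList_iso_sum N h0 hadd L
      rw [hs] at e
      refine app_eq_of_iso e.symm (app_tensorList_eq hG _ (by simp [L]) fun i hi => ?_)
      rw [List.eraseIdx_map]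
      obtain ⟨e'⟩ := tensorList_iso_sum N h0 hadd (L.eraseIdx i)
      exact app_eq_of_iso e' (ih _ (hs ▸ List.sum_eraseIdx_lt L hL (by simpa using hi)))

end Detection

/-! ### The small projective generator and its exact degree -/

section Generator

variable {C : Type} [Category.{0} C] [MonoidalCategory C] [ZeroUnit C]
  {k : Type u} [CommRing k]

/-- If every object is a sum of copies of one object, and if there is a functor of degree at most
`d` whose `d`-th cross effect does not vanish at `d` copies of this object, then the functors of
degree at most `d` have a small projective generator of degree equal to `d`. -/
theorem exists_faithfulSmallProjective (N : ℕ → C) (hN : ∀ X, ∃ n, Nonempty (X ≅ N n))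
    (h0 : Nonempty (𝟙_ C ≅ N 0)) (hadd : ∀ m n, Nonempty (N m ⊗ N n ≅ N (m + n))) {d : ℕ}
    {F : C ⥤ ModuleCat.{u} k} (hF : DegreeLE F d)
    (hFd : crossEffect F (List.replicate d (N 1)) ≠ ⊥) :
    ∃ P : PolyModules C k d, DegreeEq P.obj d ∧ IsFaithfulSmallProjective.{u} P := by
  let Z := tensorList (List.replicate d (N 1))
  refine ⟨polyRep k d Z, ⟨(polyRep k d Z).property, fun hv => ?_⟩, ⟨⟨?_⟩, fun J => ?_, ?_⟩⟩
  · obtain ⟨x, hx, hx0⟩ := Submodule.exists_mem_ne_zero_of_ne_bot hFd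
    have hp := (crossEffect_eq_bot_iff _ _).1 (hv (List.replicate d (N 1)) (by simp))
    -- The morphism sending the universal element to `x` also sends its projection to `x`; a
    -- vanishing projector on `P` would force `x = 0`.
    have h := map_crossProj _ (polyRepDesc hF x) (polyRepElem k d Z)
    rw [hp, LinearMap.zero_apply, map_zero, polyRepDesc_elem, crossProj_of_mem _ _ hx] at h
    exact hx0 h.symm
  · intro G G' a b hab
    have hZ : a.hom.app Z = b.hom.app Z := by
      refine ModuleCat.hom_ext (LinearMap.ext fun x => ?_)
      have h := congrArg (fun f => (polyRepHomEquiv d Z G') (f.hom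
        ((polyRepHomEquiv d Z G).symm x))) hab
      change (a.hom.app Z).hom ((polyRepHomEquiv d Z G) ((polyRepHomEquiv d Z G).symm x)) =
        (b.hom.app Z).hom ((polyRepHomEquiv d Z G) ((polyRepHomEquiv d Z G).symm x)) at h
      rwa [AddEquiv.apply_symm_apply] at h
    obtain ⟨e⟩ := tensorList_replicate_iso N h0 hadd d
    refine ObjectProperty.hom_ext _ (NatTrans.ext (funext fun X => ?_))
    obtain ⟨n, ⟨e'⟩⟩ := hN X
    exact app_eq_of_iso e' (app_eq_of_app_eq N h0 hadd G'.property (app_eq_of_iso e.symm hZ) n)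
  · exact polyRep_preservesColimits d Z (Discrete J)
  · exact polyRep_projective d Z

end Generator

/-! ### Functions on groups that are additive in each variable -/

section MultiAdditive

variable (k : Type u) [CommRing k] (d : ℕ) (H : Type) [Group H]

/-- The `k`-valued functions of `d` variables in a group that are additive in each variable. -/
def multiAdd : Submodule k ((Fin d → H) → k) where
  carrier := {f | ∀ (x : Fin d → H) (i : Fin d) (a b : H), f (Function.update x i (a * b)) =
    f (Function.update x i a) + f (Function.update x i b)}
  zero_mem' _ _ _ _ := (add_zero _).symm
  add_mem' {f g} hf hg x i a b := by
    simp only [Pi.add_apply]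
    rw [hf, hg]
    exact add_add_add_comm _ _ _ _
  smul_mem' t f hf x i a b := by
    simp only [Pi.smul_apply]
    rw [hf, smul_add]

variable {k d H}

theorem multiAdd_update_one (f : multiAdd k d H) (x : Fin d → H) (i : Fin d) :
    f.1 (Function.update x i 1) = 0 := by
  have h := f.2 x i 1 1
  rw [mul_one] at h
  simpa using h

theorem multiAdd_update_inv (f : multiAdd k d H) (x : Fin d → H) (i : Fin d) (a : H) :
    f.1 (Function.update x i a⁻¹) = -f.1 (Function.update x i a) := by
  have h := f.2 x i a⁻¹ a
  rw [inv_mul_cancel, multiAdd_update_one] at h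
  exact eq_neg_of_add_eq_zero_left h.symm

theorem multiAdd_eq_zero_of_closure (f : multiAdd k d H) {S : Set H}
    (hS : Subgroup.closure S = ⊤) (hf : ∀ x : Fin d → H, (∀ i, x i ∈ S) → f.1 x = 0) : f = 0 := by
  -- `T` is the set of coordinates allowed to be arbitrary; they are freed one at a time, by
  -- additivity in that coordinate.
  have key : ∀ (T : Finset (Fin d)) (x : Fin d → H), (∀ i ∉ T, x i ∈ S) → f.1 x = 0 := by
    intro T
    induction T using Finset.induction_on with
    | empty => exact fun x hx => hf x fun i => hx i (Finset.notMem_empty i)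
    | insert i T _ ih =>
      intro x hx
      have h : ∀ a ∈ Subgroup.closure S, f.1 (Function.update x i a) = 0 := by
        intro a ha
        induction ha using Subgroup.closure_induction with
        | mem a ha =>
          refine ih _ fun j hj => ?_
          by_cases hji : j = i
          · subst hji
            rwa [Function.update_self]
          · rw [Function.update_of_ne hji]
            exact hx j (by simp [hji, hj])
        | one => exact multiAdd_update_one f x i
        | mul a b _ _ ha hb => rw [f.2, ha, hb, add_zero]
        | inv a _ ha => rw [multiAdd_update_inv, ha, neg_zero]
      have h1 := h (x i) (hS ▸ Subgroup.mem_top _)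
      rwa [Function.update_eq_self] at h1
  exact Subtype.ext (funext fun x => key Finset.univ x fun i hi => absurd (Finset.mem_univ i) hi)

variable (k d) in
/-- Precomposition of multi-additive functions with a group homomorphism. -/
def multiAddPullback {H' : Type} [Group H'] (φ : H →* H') :
    multiAdd k d H' →ₗ[k] multiAdd k d H where
  toFun f := ⟨fun x => f.1 (φ ∘ x), fun x i a b => by
    simp only [Function.comp_update, map_mul]
    exact f.2 _ _ _ _⟩
  map_add' _ _ := rfl
  map_smul' _ _ := rfl

theorem multiAddPullback_apply {H' : Type} [Group H'] (φ : H →* H') (f : multiAdd k d H')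
    (x : Fin d → H) : (multiAddPullback k d φ f).1 x = f.1 (φ ∘ x) :=
  rfl

/-- The elements that are fixed by all of the endomorphisms `e j`, with one exception
among the first `n`. -/
def almostFixed (n : ℕ) (e : ℕ → H →* H) : Set H :=
  {x | ∃ i < n, ∀ j ≠ i, e j x = x}

/-- Pigeonhole: each of the `d` entries of a tuple of generators has one exceptional index, so some
`m` among `d + 1` indices is exceptional for none. Then `e m` fixes the tuple, and the pullback
along `e m` has the same value there. -/
theorem multiAdd_eq_zero_of_pullback {e : ℕ → H →* H}
    (he : Subgroup.closure (almostFixed (d + 1) e) = ⊤) (f : multiAdd k d H)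
    (hf : ∀ i < d + 1, multiAddPullback k d (e i) f = 0) : f = 0 := by
  refine multiAdd_eq_zero_of_closure f he fun x hx => ?_
  choose a _ ha using hx
  obtain ⟨m, hm⟩ : ∃ m ∈ Finset.range (d + 1), m ∉ Finset.univ.image a :=
    Finset.exists_mem_notMem_of_card_lt_card
      (lt_of_le_of_lt Finset.card_image_le (by simp))
  have h := congrArg (fun g => g.1 x) (hf m (Finset.mem_range.1 hm.1))
  simp only [multiAddPullback_apply] at h
  have hx : e m ∘ x = x := funext fun i => ha i m fun hmi =>
    hm.2 (Finset.mem_image.2 ⟨i, Finset.mem_univ i, hmi.symm⟩)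
  rwa [hx] at h

variable (k) in
/-- The product of characters, as a multi-additive function. -/
def multiAddProd (χ : Fin d → H →* Multiplicative k) : multiAdd k d H :=
  ⟨fun x => ∏ i, (χ i (x i)).toAdd, fun x i a b => by
    have h : ∀ a, ∏ j, (χ j (Function.update x i a j)).toAdd =
        (χ i a).toAdd * ∏ j ∈ Finset.univ.erase i, (χ j (x j)).toAdd := by
      intro a
      rw [← Finset.mul_prod_erase _ _ (Finset.mem_univ i), Function.update_self]
      congr 1
      refine Finset.prod_congr rfl fun j hj => ?_
      rw [Function.update_of_ne (Finset.ne_of_mem_erase hj)]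
    simp only [h, map_mul, toAdd_mul, add_mul]⟩

end MultiAdditive

/-! ### Coproducts of free nilpotent groups, and summand-killing endomorphisms -/

namespace FreeNil

variable {c : ℕ}

section Coproduct

theorem toHom_counitMap (X : FreeNil c) (x : X.Grp) : toHom (counitMap X) x = 1 := by
  have h : counitMap X = (1 : X.Grp →* (𝟙_ (FreeNil c)).Grp) := to_unit_ext (C := FreeNil c) _ _
  rw [h]
  rfl

theorem toHom_zeroEnd (X : FreeNil c) (x : X.Grp) : toHom (zeroEnd X) x = 1 := by
  rw [zeroEnd, toHom_comp, toHom_counitMap, map_one]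

variable (X T : FreeNil c)

/-- The inclusion of the first summand into the monoidal product. -/
noncomputable def tensorInl : X ⟶ X ⊗ T := (coprod.inl : X ⟶ X ⨿ T)

/-- The inclusion of the second summand into the monoidal product. -/
noncomputable def tensorInr : T ⟶ X ⊗ T := (coprod.inr : T ⟶ X ⨿ T)

variable {X T} in
/-- The morphism on the monoidal product with prescribed restrictions. -/
noncomputable def tensorDesc {Z : FreeNil c} (f : X ⟶ Z) (g : T ⟶ Z) : X ⊗ T ⟶ Z :=
  (coprod.desc f g : X ⨿ T ⟶ Z)

theorem tensorInl_desc {Z : FreeNil c} (f : X ⟶ Z) (g : T ⟶ Z) :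
    tensorInl X T ≫ tensorDesc f g = f :=
  coprod.inl_desc f g

theorem tensorInr_desc {Z : FreeNil c} (f : X ⟶ Z) (g : T ⟶ Z) :
    tensorInr X T ≫ tensorDesc f g = g :=
  coprod.inr_desc f g

variable {X T} in
theorem tensor_hom_ext {Z : FreeNil c} {f g : X ⊗ T ⟶ Z}
    (h₁ : tensorInl X T ≫ f = tensorInl X T ≫ g) (h₂ : tensorInr X T ≫ f = tensorInr X T ≫ g) :
    f = g :=
  coprod.hom_ext (X := X) (Y := T) h₁ h₂

variable {X} in
theorem tensorInl_whiskerRight {X' : FreeNil c} (f : X ⟶ X') :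
    tensorInl X T ≫ f ▷ T = f ≫ tensorInl X' T :=
  coprod.inl_map f (𝟙 T)

variable {X} in
theorem tensorInr_whiskerRight {X' : FreeNil c} (f : X ⟶ X') :
    tensorInr X T ≫ f ▷ T = tensorInr X' T :=
  (coprod.inr_map f (𝟙 T)).trans (Category.id_comp _)

variable {T} in
theorem tensorInl_whiskerLeft {T' : FreeNil c} (f : T ⟶ T') :
    tensorInl X T ≫ X ◁ f = tensorInl X T' :=
  (coprod.inl_map (𝟙 X) f).trans (Category.id_comp _)

variable {T} in
theorem tensorInr_whiskerLeft {T' : FreeNil c} (f : T ⟶ T') :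
    tensorInr X T ≫ X ◁ f = f ≫ tensorInr X T' :=
  coprod.inr_map (𝟙 X) f

/-- The monoidal product of two objects has the sum of their ranks as its rank. -/
noncomputable def tensorIsoAdd : X ⊗ T ≅ add X T where
  hom := tensorDesc (inl X T) (inr X T)
  inv := desc (tensorInl X T) (tensorInr X T)
  hom_inv_id := tensor_hom_ext
    (by rw [← Category.assoc, tensorInl_desc, inl_desc, Category.comp_id])
    (by rw [← Category.assoc, tensorInr_desc, inr_desc, Category.comp_id])
  inv_hom_id := add_hom_ext
    (by rw [← Category.assoc, inl_desc, tensorInl_desc, Category.comp_id])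
    (by rw [← Category.assoc, inr_desc, tensorInr_desc, Category.comp_id])

theorem closure_range_gen : Subgroup.closure (Set.range X.gen) = ⊤ := by
  have h : Set.range X.gen = QuotientGroup.mk' _ '' Set.range FreeGroup.of := by
    rw [← Set.range_comp]
    rfl
  rw [h, ← MonoidHom.map_closure, FreeGroup.closure_range_of,
    Subgroup.map_top_of_surjective _ (QuotientGroup.mk'_surjective _)]

variable {X T} in
theorem eq_top_of_tensor {K : Subgroup (X ⊗ T).Grp} {S : Set T.Grp}
    (hS : Subgroup.closure S = ⊤)
    (h₁ : ∀ x, toHom (tensorInl X T) x ∈ K) (h₂ : ∀ x ∈ S, toHom (tensorInr X T) x ∈ K) :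
    K = ⊤ := by
  have h₂' : ∀ x, toHom (tensorInr X T) x ∈ K := by
    have h : Subgroup.closure S ≤ K.comap (toHom (tensorInr X T)) := (Subgroup.closure_le _).2 h₂
    intro x
    exact h (hS ▸ Subgroup.mem_top x)
  have h : K.comap (toHom (tensorIsoAdd X T).inv) = ⊤ := by
    rw [eq_top_iff, ← closure_range_gen, Subgroup.closure_le]
    rintro _ ⟨i, rfl⟩
    change toHom (desc (tensorInl X T) (tensorInr X T)) _ ∈ K
    rw [desc, lift_gen]
    refine Fin.addCases (fun a => ?_) (fun b => ?_) i
    · rw [Fin.addCases_left]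
      exact h₁ _
    · rw [Fin.addCases_right]
      exact h₂' _
  refine eq_top_iff.2 fun y _ => ?_
  have hy : toHom (tensorIsoAdd X T).hom y ∈ K.comap (toHom (tensorIsoAdd X T).inv) :=
    h ▸ Subgroup.mem_top _
  rwa [Subgroup.mem_comap, ← toHom_comp, Iso.hom_inv_id] at hy

end Coproduct

/-- The extension to `X ∨ T` of a sequence of endomorphisms of `T`, beginning with the endomorphism
that is trivial on `X`. -/
noncomputable def extendEnd (X : FreeNil c) {T : FreeNil c} (e : ℕ → (T ⟶ T)) :
    ℕ → (X ⊗ T ⟶ X ⊗ T)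
  | 0 => zeroEnd X ▷ T
  | i + 1 => X ◁ e i

/-- Elements of `X` are moved only by index `0`; an element of `T` with exceptional index `i` gets
exceptional index `i + 1`. Together they generate the coproduct. -/
theorem closure_almostFixed_extendEnd (X : FreeNil c) {T : FreeNil c} (e : ℕ → (T ⟶ T)) {n : ℕ}
    (he : Subgroup.closure (almostFixed n fun i => toHom (e i)) = ⊤) :
    Subgroup.closure (almostFixed (n + 1) fun i => toHom (extendEnd X e i)) = ⊤ := by
  refine eq_top_of_tensor he (fun x => Subgroup.subset_closure ⟨0, n.succ_pos, fun j hj => ?_⟩)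
    fun x hx => Subgroup.subset_closure ?_
  · obtain ⟨j, rfl⟩ := Nat.exists_eq_succ_of_ne_zero hj
    change toHom (X ◁ e j) (toHom (tensorInl X T) x) = _
    rw [← toHom_comp, tensorInl_whiskerLeft]
  · obtain ⟨i, hi, h⟩ := hx
    refine ⟨i + 1, Nat.succ_lt_succ hi, fun j hj => ?_⟩
    rcases j with _ | j
    · change toHom (zeroEnd X ▷ T) (toHom (tensorInr X T) x) = _
      rw [← toHom_comp, tensorInr_whiskerRight]
    · change toHom (X ◁ e j) (toHom (tensorInr X T) x) = _
      rw [← toHom_comp, tensorInr_whiskerLeft, toHom_comp]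
      exact congrArg _ (h j fun hji => hj (congrArg _ hji))

variable (k : Type u) [CommRing k]

/-- There are elements `g i` and characters `χ i` for `i < n` such that `χ i (g i) = 1`, while the
endomorphism `e i` is trivial on `g i` and is annihilated by `χ i`. -/
def HasDualSystem {H : Type} [Group H] (n : ℕ) (e : ℕ → H →* H) : Prop :=
  ∃ (g : ℕ → H) (χ : ℕ → H →* Multiplicative k), ∀ i < n,
    (χ i (g i)).toAdd = 1 ∧ e i (g i) = 1 ∧ ∀ x, (χ i (e i x)).toAdd = 0

/-- The pair on `X` becomes number `0` and those on `T` are shifted by one; characters are pulled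
back along the two projections of the coproduct. -/
theorem hasDualSystem_extendEnd {X T : FreeNil c} (e : ℕ → (T ⟶ T)) {n : ℕ}
    (hX : ∃ (g : X.Grp) (χ : X.Grp →* Multiplicative k), (χ g).toAdd = 1)
    (he : HasDualSystem k n fun i => toHom (e i)) :
    HasDualSystem k (n + 1) fun i => toHom (extendEnd X e i) := by
  obtain ⟨g₀, χ₀, h₀⟩ := hX
  obtain ⟨g, χ, h⟩ := he
  let fst : X ⊗ T ⟶ X := tensorDesc (𝟙 X) (1 : T.Grp →* X.Grp)
  let snd : X ⊗ T ⟶ T := tensorDesc (1 : X.Grp →* T.Grp) (𝟙 T)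
  have hfst : zeroEnd X ▷ T ≫ fst = (1 : (X ⊗ T).Grp →* X.Grp) := by
    refine tensor_hom_ext ?_ ?_
    · rw [← Category.assoc, tensorInl_whiskerRight, Category.assoc, tensorInl_desc,
        Category.comp_id]
      exact MonoidHom.ext fun x => toHom_zeroEnd X x
    · rw [← Category.assoc, tensorInr_whiskerRight, tensorInr_desc]
      rfl
  have hsnd : ∀ i, X ◁ e i ≫ snd = snd ≫ e i := by
    intro i
    refine tensor_hom_ext ?_ ?_
    · rw [← Category.assoc, tensorInl_whiskerLeft, tensorInl_desc, ← Category.assoc,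
        tensorInl_desc]
      exact MonoidHom.ext fun x => (map_one (toHom (e i))).symm
    · rw [← Category.assoc, tensorInr_whiskerLeft, Category.assoc, tensorInr_desc,
        ← Category.assoc, tensorInr_desc, Category.comp_id, Category.id_comp]
  refine ⟨fun i => Nat.casesOn i (toHom (tensorInl X T) g₀) fun i => toHom (tensorInr X T) (g i),
    fun i => Nat.casesOn i (χ₀.comp (toHom fst)) fun i => (χ i).comp (toHom snd), fun i hi => ?_⟩
  rcases i with _ | i
  · refine ⟨?_, ?_, fun x => ?_⟩
    · change (χ₀ (toHom fst (toHom (tensorInl X T) g₀))).toAdd = 1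
      rw [← toHom_comp, tensorInl_desc]
      exact h₀
    · change toHom (zeroEnd X ▷ T) (toHom (tensorInl X T) g₀) = 1
      rw [← toHom_comp, tensorInl_whiskerRight, toHom_comp, toHom_zeroEnd, map_one]
    · change (χ₀ (toHom fst (toHom (zeroEnd X ▷ T) x))).toAdd = 0
      rw [← toHom_comp, hfst]
      change (χ₀ 1).toAdd = 0
      rw [map_one, toAdd_one]
  · obtain ⟨h1, h2, h3⟩ := h i (Nat.lt_of_succ_lt_succ hi)
    refine ⟨?_, ?_, fun x => ?_⟩
    · change (χ i (toHom snd (toHom (tensorInr X T) (g i)))).toAdd = 1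
      rw [← toHom_comp, tensorInr_desc]
      exact h1
    · change toHom (X ◁ e i) (toHom (tensorInr X T) (g i)) = 1
      rw [← toHom_comp, tensorInr_whiskerLeft, toHom_comp]
      exact (congrArg _ h2).trans (map_one _)
    · change (χ i (toHom snd (toHom (X ◁ e i) x))).toAdd = 0
      rw [← toHom_comp, hsnd, toHom_comp]
      exact h3 _

theorem exists_character_rank_one (hc : 1 ≤ c) :
    ∃ (g : Grp (⟨1⟩ : FreeNil c)) (χ : Grp (⟨1⟩ : FreeNil c) →* Multiplicative k),
      (χ g).toAdd = 1 := by
  let φ : FreeGroup (Fin 1) →* Multiplicative k := FreeGroup.lift fun _ => Multiplicative.ofAdd 1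
  have h : ∀ x ∈ (⊤ : Subgroup (FreeGroup (Fin 1))).lowerCentralSeries c, φ x = 1 := by
    intro x hx
    -- With numbering from `0`, term `1` is the commutator subgroup; as `c ≥ 1`, every homomorphism
    -- to the abelian group `k` kills term `c`.
    have h1 := Subgroup.lowerCentralSeries_antitone _ hc hx
    rw [Subgroup.top_lowerCentralSeries_one] at h1
    exact Abelianization.commutator_subset_ker φ h1
  refine ⟨gen ⟨1⟩ 0, QuotientGroup.lift _ φ h, ?_⟩
  change (φ (FreeGroup.of 0)).toAdd = 1
  rw [FreeGroup.lift_apply_of]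
  rfl

end FreeNil

section OppositeEnd

variable {C : Type w} [Category.{v} C] [MonoidalCategory C] [ZeroUnit C]

theorem unop_zeroEnd (X : Cᵒᵖ) : (zeroEnd X).unop = zeroEnd X.unop := by
  have h1 : (unitMap X).unop = counitMap X.unop := to_unit_ext _ _
  have h2 : (counitMap X).unop = unitMap X.unop := from_unit_ext _ _
  rw [zeroEnd, unop_comp, h1, h2, zeroEnd]

end OppositeEnd

namespace FreeNil

variable {c : ℕ}

/-! ### Generation and dual systems for iterated products, in both variances -/

section Systems

instance subsingleton_unit : Subsingleton (Grp (𝟙_ (FreeNil c))) :=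
  ⟨fun x y => by
    have h (z : Grp (𝟙_ (FreeNil c))) : z = 1 := by
      have h1 : counitMap (𝟙_ (FreeNil c)) = 𝟙 _ := to_unit_ext _ _
      have h2 := toHom_counitMap (𝟙_ (FreeNil c)) z
      rwa [h1] at h2
    rw [h x, h y]⟩

theorem omitEnd_cons (X : FreeNil c) (L : List (FreeNil c)) :
    (fun i => toHom (omitEnd (X :: L) i)) = fun i => toHom (extendEnd X (omitEnd L) i) :=
  funext fun i => by cases i <;> rfl

theorem closure_almostFixed_omitEnd (L : List (FreeNil c)) :
    Subgroup.closure (almostFixed L.length fun i => toHom (omitEnd L i)) = ⊤ := by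
  induction L with
  | nil =>
    -- With no factors `almostFixed` is empty, but the group is trivial.
    have : Subsingleton (Grp (tensorList ([] : List (FreeNil c)))) := subsingleton_unit
    exact Subsingleton.elim _ _
  | cons X L ih =>
    have h := closure_almostFixed_extendEnd X (omitEnd L) ih
    rw [← omitEnd_cons] at h
    exact h

theorem omitEnd_cons_unop (X : (FreeNil c)ᵒᵖ) (L : List (FreeNil c)ᵒᵖ) :
    (fun i => toHom (omitEnd (X :: L) i).unop) =
      fun i => toHom (extendEnd X.unop (fun i => (omitEnd L i).unop) i) := by
  refine funext fun i => ?_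
  rcases i with _ | i
  · change toHom ((zeroEnd X).unop ▷ (tensorList L).unop) = _
    rw [unop_zeroEnd]
    rfl
  · rfl

theorem closure_almostFixed_omitEnd_unop (L : List (FreeNil c)ᵒᵖ) :
    Subgroup.closure (almostFixed L.length fun i => toHom (omitEnd L i).unop) = ⊤ := by
  induction L with
  | nil =>
    have : Subsingleton (Grp (tensorList ([] : List (FreeNil c)ᵒᵖ)).unop) := subsingleton_unit
    exact Subsingleton.elim _ _
  | cons X L ih =>
    have h := closure_almostFixed_extendEnd X.unop (fun i => (omitEnd L i).unop) ih
    rw [← omitEnd_cons_unop] at h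
    exact h

variable (k : Type u) [CommRing k]

theorem hasDualSystem_omitEnd (hc : 1 ≤ c) (d : ℕ) :
    HasDualSystem k d fun i => toHom (omitEnd (List.replicate d (⟨1⟩ : FreeNil c)) i) := by
  induction d with
  | zero => exact ⟨fun _ => 1, fun _ => 1, fun i hi => absurd hi i.not_lt_zero⟩
  | succ d ih =>
    have h := hasDualSystem_extendEnd k _ (exists_character_rank_one k hc) ih
    rw [← omitEnd_cons] at h
    exact h

theorem hasDualSystem_omitEnd_unop (hc : 1 ≤ c) (d : ℕ) :
    HasDualSystem k d fun i =>
      toHom (omitEnd (List.replicate d (op (⟨1⟩ : FreeNil c))) i).unop := by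
  induction d with
  | zero => exact ⟨fun _ => 1, fun _ => 1, fun i hi => absurd hi i.not_lt_zero⟩
  | succ d ih =>
    have h := hasDualSystem_extendEnd k
      (fun i => (omitEnd (List.replicate d (op (⟨1⟩ : FreeNil c))) i).unop)
      (exists_character_rank_one k hc) ih
    rw [← omitEnd_cons_unop (op (⟨1⟩ : FreeNil c))] at h
    exact h

variable {k}

/-- The function is the product of the characters and the tuple is that of the dual elements. The
function serves the contravariant functor, evaluation at the tuple the covariant one. -/
theorem HasDualSystem.exists_multiAdd {H : Type} [Group H] [Nontrivial k] {d : ℕ}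
    {e : ℕ → H →* H} (h : HasDualSystem k d e) :
    ∃ (f : multiAdd k d H) (x : Fin d → H), f.1 x ≠ 0 ∧
      (∀ i < d, multiAddPullback k d (e i) f = 0) ∧ ∀ i < d, ∃ j, e i (x j) = 1 := by
  obtain ⟨g, χ, h⟩ := h
  refine ⟨multiAddProd k fun i : Fin d => χ i, fun i : Fin d => g i, ?_, fun i hi => ?_,
    fun i hi => ⟨⟨i, hi⟩, (h i hi).2.1⟩⟩
  · change ∏ i : Fin d, (χ i (g i)).toAdd ≠ 0
    rw [Finset.prod_eq_one fun (i : Fin d) _ => (h i i.2).1]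
    exact one_ne_zero
  · refine Subtype.ext (funext fun x => ?_)
    exact Finset.prod_eq_zero (Finset.mem_univ (⟨i, hi⟩ : Fin d)) ((h i hi).2.2 _)

end Systems

/-! ### Test functors of degree exactly `d` -/

section Functors

variable (c) (k : Type u) [CommRing k] (d : ℕ)

/-- The contravariant functor of multi-additive functions of `d` variables. -/
def multiAddFunctor : (FreeNil c)ᵒᵖ ⥤ ModuleCat.{u} k where
  obj X := ModuleCat.of k (multiAdd k d X.unop.Grp)
  map f := ModuleCat.ofHom (multiAddPullback k d (toHom f.unop))
  map_id _ := rfl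
  map_comp _ _ := rfl

/-- The covariant functor of linear forms on the multi-additive functions of `d` variables. -/
def multiAddDualFunctor : FreeNil c ⥤ ModuleCat.{u} k where
  obj X := ModuleCat.of k (Module.Dual k (multiAdd k d X.Grp))
  map f := ModuleCat.ofHom (multiAddPullback k d (toHom f)).dualMap
  map_id _ := rfl
  map_comp _ _ := rfl

theorem degreeLE_multiAddFunctor : DegreeLE (multiAddFunctor c k d) d := by
  intro L hL
  refine (Submodule.eq_bot_iff _).2 fun f hf => ?_
  rw [mem_crossEffect_iff, hL] at hf
  have h := closure_almostFixed_omitEnd_unop L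
  rw [hL] at h
  exact multiAdd_eq_zero_of_pullback h f hf

/-- The product of the complements vanishes on multi-additive functions by the contravariant
argument, while a form `y` in the cross effect is unchanged by composition with it. -/
theorem degreeLE_multiAddDualFunctor : DegreeLE (multiAddDualFunctor c k d) d := by
  intro L hL
  refine (Submodule.eq_bot_iff _).2
    fun (y : Module.Dual k (multiAdd k d (tensorList L).Grp)) hy => ?_
  replace hy := (mem_crossEffect_iff (multiAddDualFunctor c k d) L y).1 hy
  rw [hL] at hy
  have h := closure_almostFixed_omitEnd L
  rw [hL] at h
  let e (i : ℕ) : Module.End k (multiAdd k d (tensorList L).Grp) :=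
    multiAddPullback k d (toHom (omitEnd L i))
  have hz (f : multiAdd k d (tensorList L).Grp) : complProd e (List.range (d + 1)) f = 0 := by
    refine multiAdd_eq_zero_of_pullback h _ fun i hi => ?_
    have he := mul_complProd_eq_zero e
      (fun i j => congrArg (fun φ : tensorList L ⟶ tensorList L => multiAddPullback k d (toHom φ))
        (omitEnd_comm L i j))
      (fun i => congrArg (fun φ : tensorList L ⟶ tensorList L => multiAddPullback k d (toHom φ))
        (omitEnd_idem L i))
      (List.range (d + 1)) (List.mem_range.2 hi)
    exact DFunLike.congr_fun he f
  refine LinearMap.ext (f := y) (g := 0) fun f => ?_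
  have h1 := map_complProd_apply_of_eq_zero e y (List.range (d + 1))
    (fun i hi f => LinearMap.congr_fun (hy i (List.mem_range.1 hi) :
      y ∘ₗ e i = 0) f) f
  rw [hz, map_zero] at h1
  exact h1.symm

variable {c} [Nontrivial k]

theorem crossEffect_multiAddFunctor_ne_bot (hc : 1 ≤ c) :
    crossEffect (multiAddFunctor c k d) (List.replicate d (op ⟨1⟩)) ≠ ⊥ := by
  obtain ⟨f, x, hfx, hf, -⟩ := (hasDualSystem_omitEnd_unop k hc d).exists_multiAdd
  refine (Submodule.ne_bot_iff _).2 ⟨f, ?_, fun h => hfx (by rw [h]; rfl)⟩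
  refine (mem_crossEffect_iff (multiAddFunctor c k d) _ f).2 ?_
  rw [List.length_replicate]
  exact hf

theorem crossEffect_multiAddDualFunctor_ne_bot (hc : 1 ≤ c) :
    crossEffect (multiAddDualFunctor c k d) (List.replicate d ⟨1⟩) ≠ ⊥ := by
  obtain ⟨f, x, hfx, -, hx⟩ := (hasDualSystem_omitEnd k hc d).exists_multiAdd
  let y : Module.Dual k (multiAdd k d (tensorList (List.replicate d (⟨1⟩ : FreeNil c))).Grp) :=
    (LinearMap.proj x).comp (Submodule.subtype _)
  refine (Submodule.ne_bot_iff _).2 ⟨y, ?_, fun h => hfx (LinearMap.congr_fun (h : y = 0) f)⟩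
  refine (mem_crossEffect_iff (multiAddDualFunctor c k d) _ y).2 ?_
  rw [List.length_replicate]
  intro i hi
  obtain ⟨j, hj⟩ := hx i hi
  refine LinearMap.ext (f := y ∘ₗ multiAddPullback k d (toHom (omitEnd _ i))) (g := 0) fun f => ?_
  change f.1 (toHom (omitEnd _ i) ∘ x) = 0
  -- Entry `j` of the transformed tuple is already `1`, so the update changes nothing.
  have h := multiAdd_update_one f (toHom (omitEnd _ i) ∘ x) j
  rwa [← hj, ← Function.comp_apply (f := toHom (omitEnd _ i)), Function.update_eq_self] at h

end Functors

theorem exists_iso_rank (X : FreeNil c) : ∃ n, Nonempty (X ≅ ⟨n⟩) :=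
  ⟨X.rank, ⟨Iso.refl _⟩⟩

theorem unit_iso : Nonempty (𝟙_ (FreeNil c) ≅ ⟨0⟩) :=
  ⟨(ZeroUnit.isZero_unit (C := FreeNil c)).iso isZero_zero⟩

theorem tensor_iso (m n : ℕ) : Nonempty ((⟨m⟩ : FreeNil c) ⊗ ⟨n⟩ ≅ ⟨m + n⟩) :=
  ⟨tensorIsoAdd _ _⟩

theorem unit_iso_op : Nonempty (𝟙_ (FreeNil c)ᵒᵖ ≅ op ⟨0⟩) :=
  ⟨(ZeroUnit.isZero_unit (C := (FreeNil c)ᵒᵖ)).iso isZero_zero.op⟩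

theorem tensor_iso_op (m n : ℕ) :
    Nonempty (op (⟨m⟩ : FreeNil c) ⊗ op ⟨n⟩ ≅ op ⟨m + n⟩) :=
  ⟨(tensorIsoAdd ⟨m⟩ ⟨n⟩).symm.op⟩

end FreeNil

/-! ### The theorem for both categories -/

open FreeNil

theorem degreeSet_eq_univ {C : Type w} [Category.{v} C] [MonoidalCategory C] [ZeroUnit C]
    {k : Type u} [CommRing k]
    (h : ∀ d, ∃ P : PolyModules C k d, DegreeEq P.obj d ∧ IsFaithfulSmallProjective.{u} P) :
    degreeSet C k = Set.univ :=
  Set.eq_univ_of_forall fun d => let ⟨P, hP, _⟩ := h d; ⟨P.obj, hP⟩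

theorem theoremA (k : Type u) [CommRing k] [Nontrivial k] (c : ℕ) (hc : 1 ≤ c) :
    (degreeSet (FreeNil c) k = Set.univ ∧
      ∀ d : ℕ, ∃ P : PolyModules (FreeNil c) k d,
        DegreeEq P.obj d ∧ IsFaithfulSmallProjective.{u} P) ∧
    (degreeSet (FreeNil c)ᵒᵖ k = Set.univ ∧
      ∀ d : ℕ, ∃ P : PolyModules (FreeNil c)ᵒᵖ k d,
        DegreeEq P.obj d ∧ IsFaithfulSmallProjective.{u} P) := by
  have h (d : ℕ) : ∃ P : PolyModules (FreeNil c) k d,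
      DegreeEq P.obj d ∧ IsFaithfulSmallProjective.{u} P :=
    exists_faithfulSmallProjective (fun n => ⟨n⟩) exists_iso_rank unit_iso tensor_iso
      (degreeLE_multiAddDualFunctor c k d) (crossEffect_multiAddDualFunctor_ne_bot k d hc)
  have hop (d : ℕ) : ∃ P : PolyModules (FreeNil c)ᵒᵖ k d,
      DegreeEq P.obj d ∧ IsFaithfulSmallProjective.{u} P := by
    have hd := crossEffect_multiAddFunctor_ne_bot k d hc
    refine exists_faithfulSmallProjective (fun n => op ⟨n⟩)
      (fun X => (exists_iso_rank X.unop).imp fun _ ⟨e⟩ => ⟨e.symm.op⟩)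
      unit_iso_op tensor_iso_op
      (degreeLE_multiAddFunctor c k d) ?_
    exact hd
  exact ⟨⟨degreeSet_eq_univ h, h⟩, ⟨degreeSet_eq_univ hop, hop⟩⟩
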